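/- Let $X$ be a nonempty set, $X^*$ the set of all nonempty finite subsets of $X$, $H$ a real normed vector space (for instance a separable Hilbert space), and $f:X^*\to H$ a function; write $f(x)$ for $f(\{x\})$. Assume that $f$ is strongly rich, i.e. for every $x\in X$ there are $y,z\in X$ such that $f(x),f(y),f(z)$ are not collinear, $f(\{x,y\})\notin\{f(x),f(y)\}$ and $f(\{x,z\})\notin\{f(x),f(z)\}$. A weak order on $X$ is a reflexive, transitive and complete binary relation $\succcurlyeq$; write $x\sim y$ if $x\succcurlyeq y$ and $y\succcurlyeq x$, and for $A\in X^*$ let $M(A,\succcurlyeq)=\{x\in A: x\succcurlyeq y \text{ for all } y\in A\}$. Then the following are equivalent: 1. (Weighted averaging) For all disjoint $A,B\in X^*$ there is $\lambda\in[0,1]$ with $f(A\cup B)=\lambda f(A)+(1-\lambda)f(B)$. 2. There is a unique weak order $\succcurlyeq$ on $X$ for which there exists a weight function $w:X\to(0,\infty)$ such that for every $A\in X^*$ $$f(A)=\sum_{x\in M(A,\succcurlyeq)}\frac{w(x)}{\sum_{y\in M(A,\succcurlyeq)}w(y)}\,f(x).$$ Moreover, in this case $w$ is unique up to multiplication by a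 positive number on each equivalence class of $\succcurlyeq$: if $w$ is such a weight function for $\succcurlyeq$, then $w':X\to(0,\infty)$ is another one if and only if $w'=c\,w$ for some $c:X\to(0,\infty)$ that is constant on each $\sim$-equivalence class. -/

import Mathlib

namespace ModelAggregation

/-- `X^*`: the set of all nonempty finite subsets of `X`. -/
abbrev Coalition (X : Type*) : Type _ := {A : Finset X // A.Nonempty}

/-- The coalition `{x}`. -/
def single {X : Type*} (x : X) : Coalition X := ⟨{x}, Finset.singleton_nonempty x⟩

open Classical in
/-- The union of two coalitions. -/
noncomputable def union {X : Type*} (A B : Coalition X) : Coalition X :=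
  ⟨A.1 ∪ B.1, A.2.mono Finset.subset_union_left⟩

/-- The coalition `{x, y}`. -/
noncomputable def pair {X : Type*} (x y : X) : Coalition X := union (single x) (single y)

/-- The weighted averaging axiom: for disjoint `A` and `B`, the value `f (A ∪ B)` is
`l • f A + (1 - l) • f B` for some `l ∈ [0, 1]`, which may depend on `A` and `B`. -/
def WeightedAveraging {X H : Type*} [NormedAddCommGroup H] [NormedSpace ℝ H]
    (f : Coalition X → H) : Prop :=
  ∀ A B : Coalition X, Disjoint A.1 B.1 →
    ∃ l : ℝ, l ∈ Set.Icc (0 : ℝ) 1 ∧ f (union A B) = l • f A + (1 - l) • f B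

/-- Strong richness of an aggregation rule. -/
def StronglyRich {X H : Type*} [NormedAddCommGroup H] [NormedSpace ℝ H]
    (f : Coalition X → H) : Prop :=
  ∀ x : X, ∃ y z : X,
    ¬ Collinear ℝ {f (single x), f (single y), f (single z)} ∧
    f (pair x y) ∉ ({f (single x), f (single y)} : Set H) ∧
    f (pair x z) ∉ ({f (single x), f (single z)} : Set H)

/-- A weak order: a reflexive, transitive and complete binary relation
(`R x y` is read "`x` is ranked at least as high as `y`"). -/
structure IsWeakOrder {X : Type*} (R : X → X → Prop) : Prop where
  refl : ∀ x, R x x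
  trans : ∀ x y z, R x y → R y z → R x z
  complete : ∀ x y, R x y ∨ R y x

open Classical in
/-- `M(A, R)`: the highest-ordered elements of `A`. -/
noncomputable def maximals {X : Type*} (R : X → X → Prop) (A : Coalition X) : Finset X :=
  A.1.filter (fun x => ∀ y ∈ A.1, R x y)

/-- `w` is a strictly positive weight function and, for every coalition `A`, `f A` is the
`w`-weighted average of the values `f {x}` over the highest-ordered elements `x` of `A`. -/
def Represents {X H : Type*} [NormedAddCommGroup H] [NormedSpace ℝ H]
    (f : Coalition X → H) (R : X → X → Prop) (w : X → ℝ) : Prop :=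
  (∀ x, 0 < w x) ∧
  ∀ A : Coalition X,
    f A = ∑ x ∈ maximals R A, (w x / ∑ y ∈ maximals R A, w y) • f (single x)

end ModelAggregation

open ModelAggregation

/-!
Fix a strongly rich rule `f` satisfying weighted averaging. For points `x`, `y` with different
values, the position of `f {x, y}` on the segment between them gives the relative weight
`r x y ∈ [0, ∞]` of `x` against `y`. If the values of `x`, `y`, `z` are not collinear, the three
ways of splitting `{x, y, z}` into a pair and a point give the barycentric coordinates of
`f {x, y, z}`, and hence `r x z = r x y * r y z` whenever the product is not `0 * ∞`
(`ratioSystem_of_weightedAveraging`, a form of Ceva's theorem).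

Collinear and coinciding values are handled by detours. Strong richness gives every point `x`, for
every line through its value, a neighbour `c` off this line with `0 < r x c < ∞`. If
the values of `c` and `y` differ then `r x c * r c y` does not depend on the choice of `c`. It
extends `r` to all pairs and is multiplicative without
restriction on the position of the values (`RatioSystem.through_mul`). Such a cocycle is the same
thing as a weak order, in which two points are equivalent if their relative weight is finite and
nonzero, together with weights on every class (`exists_weakOrder_of_cocycle`).

So `f` agrees with the weighted average `g` over the highest-ordered elements on all pairs, and `g`
satisfies weighted averaging too (`topAverage_union_mem_segment`). The general case is an induction
on the size of a coalition `A` (`eq_topAverage_of_pairs`). Both `f A` and `g A` lie on the segment from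
`f {x}` to `g (A \ {x})` for every `x ∈ A`; so if they differ, the line `L` through them contains all
values of points of `A`. Take `d` off `L` and equivalent to the highest-ranked points of `A`. For a
suitable `x ∈ A`, the splittings of `A ∪ {d}` into `{x}` and the rest, and into `A \ {x}` and
`{x, d}`, confine `f (A ∪ {d})` and `g (A ∪ {d})` to two segments that are not on one line. Hence
these points agree, and projecting from `d` to `L` gives `f A = g A`.

Uniqueness of the order and of the weights is visible on pairs when the two values differ, and
otherwise follows by comparison with a neighbour (`Represents.order_unique`,
`Represents.div_eq_of_equiv`).
-/

/-! ### Lines, segments and barycentric coordinates -/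

section Geometry

variable {H : Type*} [NormedAddCommGroup H] [NormedSpace ℝ H]

/-- Two distinct points of a segment span a line through both of its endpoints. -/
lemma endpoints_mem_line {u v a b : H} (huv : u ≠ v) (hu : u ∈ segment ℝ a b)
    (hv : v ∈ segment ℝ a b) : a ∈ line[ℝ, u, v] ∧ b ∈ line[ℝ, u, v] := by
  rw [segment_eq_image_lineMap] at hu hv
  obtain ⟨s, -, rfl⟩ := hu
  obtain ⟨t, -, rfl⟩ := hv
  have hst : t - s ≠ 0 := by
    rintro h
    exact huv (by rw [sub_eq_zero.1 h])
  constructor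
  · convert AffineMap.lineMap_mem_affineSpan_pair (-s / (t - s)) _ _ using 1
    simp only [AffineMap.lineMap_apply_module]
    match_scalars <;> field_simp <;> ring
  · convert AffineMap.lineMap_mem_affineSpan_pair ((1 - s) / (t - s)) _ _ using 1
    simp only [AffineMap.lineMap_apply_module]
    match_scalars <;> field_simp <;> ring

/-- A line sharing two distinct points with `line[ℝ, u, v]` is contained in it. -/
lemma mem_line_of_two_common {u v u' v' a b c : H} (hab : a ≠ b)
    (ha : a ∈ line[ℝ, u, v]) (hb : b ∈ line[ℝ, u, v])
    (ha' : a ∈ line[ℝ, u', v']) (hb' : b ∈ line[ℝ, u', v']) (hc' : c ∈ line[ℝ, u', v']) :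
    c ∈ line[ℝ, u, v] := by
  have h := collinear_triple_of_mem_affineSpan_pair ha' hb' hc'
  have h2 : c ∈ line[ℝ, a, b] := h.mem_affineSpan_of_mem_of_ne (by simp) (by simp) (by simp) hab
  exact affineSpan_pair_le_of_mem_of_mem ha hb h2

/-- A line through a point of `L` and a further point of `L` stays in `L`. -/
lemma mem_of_combo_mem {L : AffineSubspace ℝ H} {d u : H} {s : ℝ} (hs : s ≠ 0) (hu : u ∈ L)
    (h : s • d + (1 - s) • u ∈ L) : d ∈ L := by
  convert AffineMap.lineMap_mem s⁻¹ hu h using 1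
  simp only [AffineMap.lineMap_apply_module]
  match_scalars <;> field_simp
  ring

/-- Projection from a point `d` off `L` is injective on `L`: if the segments from `d` to two
points of `L` share a point other than `d`, those two points agree. -/
lemma eq_of_combo_eq {L : AffineSubspace ℝ H} {d u v : H} {s s' : ℝ} (hd : d ∉ L)
    (hu : u ∈ L) (hv : v ∈ L) (hs : s ≠ 1)
    (h : s • d + (1 - s) • u = s' • d + (1 - s') • v) : u = v := by
  have hss : s = s' := by
    by_contra hne
    have hne' : s - s' ≠ 0 := sub_ne_zero.2 hne
    apply hd
    convert AffineMap.lineMap_mem ((1 - s') / (s - s')) hu hv using 1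
    simp only [AffineMap.lineMap_apply_module]
    have h2 : (s - s') • d = (1 - s') • v - (1 - s) • u := by
      linear_combination (norm := module) (1 : ℝ) • h
    have h3 : d = (s - s')⁻¹ • ((1 - s') • v - (1 - s) • u) := by
      rw [← h2, smul_smul, inv_mul_cancel₀ hne', one_smul]
    rw [h3]
    match_scalars <;> field_simp
    ring
  subst hss
  have h1 : (1 - s) • u = (1 - s) • v := add_left_cancel h
  exact smul_right_injective H (sub_ne_zero.2 hs.symm) h1

lemma combo_left_cancel {a b : H} (hab : a ≠ b) {s t : ℝ}
    (h : s • a + (1 - s) • b = t • a + (1 - t) • b) : s = t := by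
  have h1 : (s - t) • (a - b) = 0 := by
    linear_combination (norm := module) (1 : ℝ) • h
  rcases smul_eq_zero.1 h1 with h2 | h2
  · linarith
  · exact absurd (sub_eq_zero.1 h2) hab

/-- Barycentric coordinates with respect to a nondegenerate triangle are unique. -/
lemma barycentric_unique {a b c : H} (h : ¬ Collinear ℝ {a, b, c}) {x y z x' y' z' : ℝ}
    (hs : x + y + z = x' + y' + z')
    (he : x • a + y • b + z • c = x' • a + y' • b + z' • c) : x = x' ∧ y = y' ∧ z = z' := by
  rw [← affineIndependent_iff_not_collinear_set, affineIndependent_iff_linearIndependent_vsub ℝ _ 0,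
    ← linearIndependent_equiv (finSuccAboveEquiv (0 : Fin 3))] at h
  have h' := Fintype.linearIndependent_iff.1 h ![y - y', z - z'] (by
    have hx : x = x' + y' + z' - y - z := by linarith
    subst hx
    simp [Fin.sum_univ_two, finSuccAboveEquiv]
    linear_combination (norm := module) (1 : ℝ) • he)
  have h1 := h' 0
  have h2 := h' 1
  simp at h1 h2
  exact ⟨by linarith, by linarith, by linarith⟩

end Geometry

/-! ### Odds -/

/-- The odds `l / (1 - l)` of `l ∈ [0, 1]`, with value `∞` at `l = 1`. -/
noncomputable def odds (l : ℝ) : ENNReal := ENNReal.ofReal l / ENNReal.ofReal (1 - l)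

lemma odds_eq_zero {l : ℝ} (h0 : 0 ≤ l) : odds l = 0 ↔ l = 0 := by
  simp only [odds, ENNReal.div_eq_zero_iff, ENNReal.ofReal_eq_zero, ENNReal.ofReal_ne_top, or_false]
  exact ⟨fun h => le_antisymm h h0, fun h => h.le⟩

lemma odds_eq_top {l : ℝ} (h1 : l ≤ 1) : odds l = ⊤ ↔ l = 1 := by
  simp only [odds, ENNReal.div_eq_top, ENNReal.ofReal_eq_zero, ENNReal.ofReal_ne_top, false_and,
    or_false, ne_eq, not_le]
  exact ⟨fun h => by linarith [h.2], fun h => by constructor <;> linarith⟩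

lemma odds_of_lt_one {l : ℝ} (h1 : l < 1) : odds l = ENNReal.ofReal (l / (1 - l)) := by
  rw [odds, ENNReal.ofReal_div_of_pos (by linarith)]

lemma odds_one_sub (l : ℝ) (h0 : 0 ≤ l) (h1 : l ≤ 1) : odds (1 - l) = (odds l)⁻¹ := by
  rw [odds, odds, sub_sub_cancel, ENNReal.inv_div (by simp)]
  by_cases h : l = 0
  · left; subst h; simp
  · right; simp [lt_of_le_of_ne h0 (Ne.symm h)]

/-- If `l₁`, `l₂`, `l₃` are the shares of the first coordinate within the pairs `(α, β)`,
`(β, γ)`, `(α, γ)` then the odds multiply, the indeterminate product `0 * ∞` excepted. -/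
lemma odds_mul {α β γ l₁ l₂ l₃ : ℝ} (hα : 0 ≤ α) (hβ : 0 ≤ β) (hγ : 0 ≤ γ)
    (hsum : α + β + γ = 1) (h₁ : l₁ ∈ Set.Icc (0 : ℝ) 1) (h₂ : l₂ ∈ Set.Icc (0 : ℝ) 1)
    (h₃ : l₃ ∈ Set.Icc (0 : ℝ) 1) (e₁ : α * (1 - l₁) = β * l₁) (e₂ : β * (1 - l₂) = γ * l₂)
    (e₃ : α * (1 - l₃) = γ * l₃) (s₁ : odds l₁ ≠ 0 ∨ odds l₂ ≠ ⊤) (s₂ : odds l₁ ≠ ⊤ ∨ odds l₂ ≠ 0) :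
    odds l₃ = odds l₁ * odds l₂ := by
  rw [Ne, Ne, odds_eq_zero h₁.1, odds_eq_top h₂.2] at s₁
  rw [Ne, Ne, odds_eq_zero h₂.1, odds_eq_top h₁.2] at s₂
  by_cases t₁ : l₁ = 1
  · have hl2 : l₂ ≠ 0 := by simpa [t₁] using s₂
    have hb : β = 0 := by rw [t₁] at e₁; linarith
    have hg : γ = 0 := by
      rw [hb, zero_mul] at e₂
      exact (mul_eq_zero.1 e₂.symm).resolve_right hl2
    have t₃ : l₃ = 1 := by
      have : α = 1 := by linarith
      rw [this, hg] at e₃; linarith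
    rw [(odds_eq_top h₁.2).2 t₁, (odds_eq_top h₃.2).2 t₃, ENNReal.top_mul]
    rwa [Ne, odds_eq_zero h₂.1]
  by_cases t₂ : l₂ = 1
  · have hl1 : l₁ ≠ 0 := by simpa [t₂] using s₁
    have hg : γ = 0 := by rw [t₂] at e₂; linarith
    have ha : α ≠ 0 := by
      rintro rfl
      have : β = 1 := by linarith
      rw [this] at e₁
      exact hl1 (by linarith)
    have t₃ : l₃ = 1 := by
      rw [hg, zero_mul] at e₃
      linarith [(mul_eq_zero.1 e₃).resolve_left ha]
    rw [(odds_eq_top h₂.2).2 t₂, (odds_eq_top h₃.2).2 t₃, ENNReal.mul_top]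
    rwa [Ne, odds_eq_zero h₁.1]
  have u₁ : 0 < 1 - l₁ := sub_pos.2 (lt_of_le_of_ne h₁.2 t₁)
  have u₂ : 0 < 1 - l₂ := sub_pos.2 (lt_of_le_of_ne h₂.2 t₂)
  have eb : β = γ * (l₂ / (1 - l₂)) := by field_simp; linarith
  have ea : α = β * (l₁ / (1 - l₁)) := by field_simp; linarith
  have hg : γ ≠ 0 := by
    rintro rfl
    rw [zero_mul] at eb
    rw [eb, zero_mul] at ea
    linarith
  have t₃ : l₃ ≠ 1 := by
    rintro rfl
    apply hg; linarith
  have u₃ : 0 < 1 - l₃ := sub_pos.2 (lt_of_le_of_ne h₃.2 t₃)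
  rw [odds_of_lt_one (by linarith), odds_of_lt_one (by linarith), odds_of_lt_one (by linarith),
    ← ENNReal.ofReal_mul (div_nonneg h₁.1 u₁.le)]
  congr 1
  have ec : γ * (l₃ / (1 - l₃)) = γ * (l₁ / (1 - l₁) * (l₂ / (1 - l₂))) := by
    have : α = γ * (l₃ / (1 - l₃)) := by field_simp; linarith
    rw [← this, ea, eb]; ring
  exact mul_left_cancel₀ hg ec

/-! ### Extending the ratios across collinear configurations -/

section ENNRealFactors

variable {a b : ENNReal}

lemma ennreal_mul_eq_zero (ha : a ≠ 0) : a * b = 0 ↔ b = 0 := by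
  simp [ha]

lemma ennreal_mul_eq_top (ha : a ≠ 0) (ha' : a ≠ ⊤) : a * b = ⊤ ↔ b = ⊤ := by
  simp [ENNReal.mul_eq_top, ha, ha']

lemma ennreal_mul_eq_top' (ha : a ≠ 0) (ha' : a ≠ ⊤) : b * a = ⊤ ↔ b = ⊤ := by
  rw [mul_comm, ennreal_mul_eq_top ha ha']

end ENNRealFactors

section Cocycle

variable {X H : Type*} [NormedAddCommGroup H] [NormedSpace ℝ H]

/-- `c` is a neighbour of `x`: the two have different values, and the relative weight of `x`
against `c` is neither `0` nor `∞`. -/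
def Neighbour (p : X → H) (r : X → X → ENNReal) (x c : X) : Prop :=
  p x ≠ p c ∧ r x c ≠ 0 ∧ r x c ≠ ⊤

/-- A system of relative weights `r x y` of points with values `p x`. It is meaningful only for
`p x ≠ p y`, inverts under exchange, and is multiplicative on noncollinear triples (up to the
indeterminate product `0 * ∞`). Each point has two neighbours with which it forms a
noncollinear triple. -/
structure RatioSystem (p : X → H) (r : X → X → ENNReal) : Prop where
  symm : ∀ x y, p x ≠ p y → r y x = (r x y)⁻¹
  mul : ∀ x y z, ¬ Collinear ℝ {p x, p y, p z} → (r x y ≠ 0 ∨ r y z ≠ ⊤) →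
    (r x y ≠ ⊤ ∨ r y z ≠ 0) → r x z = r x y * r y z
  rich : ∀ x, ∃ a b, ¬ Collinear ℝ {p x, p a, p b} ∧ Neighbour p r x a ∧ Neighbour p r x b

lemma noncollinear_rotate {a b c : H} (h : ¬ Collinear ℝ {a, b, c}) : ¬ Collinear ℝ {b, c, a} := by
  intro h'; apply h; convert h' using 1; ext; simp; tauto

lemma noncollinear_swap {a b c : H} (h : ¬ Collinear ℝ {a, b, c}) : ¬ Collinear ℝ {a, c, b} := by
  intro h'; apply h; convert h' using 1; ext; simp; tauto

lemma noncollinear_ne {a b c : H} (h : ¬ Collinear ℝ {a, b, c}) : a ≠ b := by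
  rintro rfl
  apply h
  simpa using collinear_pair ℝ a c

/-- A point off a line stays off it when the line is spanned by two other points. -/
lemma noncollinear_of_collinear {a b c d : H} (hc : Collinear ℝ {a, b, c}) (hac : a ≠ c)
    (h : ¬ Collinear ℝ {a, b, d}) : ¬ Collinear ℝ {a, c, d} := by
  intro h'
  apply h
  have hab := noncollinear_ne h
  have h1 : b ∈ line[ℝ, a, c] :=
    hc.mem_affineSpan_of_mem_of_ne (by simp) (by simp) (by simp) hac
  have h2 : d ∈ line[ℝ, a, c] :=
    h'.mem_affineSpan_of_mem_of_ne (by simp) (by simp) (by simp) hac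
  exact collinear_triple_of_mem_affineSpan_pair (left_mem_affineSpan_pair ℝ a c) h1 h2

open Classical in
/-- The relative weight of `x` and `y`, measured through some neighbour of `x` whose value differs
from that of `y`. Unlike `r` it is meaningful when `p x = p y`. -/
noncomputable def through (p : X → H) (r : X → X → ENNReal) (x y : X) : ENNReal :=
  if h : ∃ c, Neighbour p r x c ∧ p c ≠ p y then r x h.choose * r h.choose y else 0

namespace RatioSystem

variable {p : X → H} {r : X → X → ENNReal}

lemma neighbour_symm (S : RatioSystem p r) {x c : X}
    (h : Neighbour p r x c) : Neighbour p r c x := by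
  refine ⟨h.1.symm, ?_, ?_⟩ <;> rw [S.symm x c h.1]
  · simpa using h.2.2
  · simpa using h.2.1

lemma neighbour_mul (S : RatioSystem p r) {x c : X}
    (h : Neighbour p r x c) : r x c * r c x = 1 := by
  rw [S.symm x c h.1, ENNReal.mul_inv_cancel h.2.1 h.2.2]

lemma exists_neighbour_off (S : RatioSystem p r) (x : X) {v : H} (hv : p x ≠ v) :
    ∃ c, Neighbour p r x c ∧ ¬ Collinear ℝ {p x, v, p c} := by
  obtain ⟨a, b, hab, ha, hb⟩ := S.rich x
  by_contra! hcon
  have h1 := hcon a ha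
  by_cases h : Collinear ℝ {p x, v, p b}
  · by_contra
    exact noncollinear_of_collinear (by convert h1 using 1; ext; simp; tauto) hv hab
      (by convert h using 1)
  · exact h (hcon b hb)

lemma exists_neighbour_ne (S : RatioSystem p r) (x y : X) : ∃ c, Neighbour p r x c ∧ p c ≠ p y := by
  obtain ⟨a, b, hab, ha, hb⟩ := S.rich x
  by_cases h : p a = p y
  · exact ⟨b, hb, fun h' => noncollinear_ne (noncollinear_rotate hab) (h.trans h'.symm)⟩
  · exact ⟨a, ha, h⟩

lemma mul_left (S : RatioSystem p r) {x y z : X} (h : ¬ Collinear ℝ {p x, p y, p z})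
    (hn : Neighbour p r x y) :
    r x z = r x y * r y z := S.mul x y z h (Or.inl hn.2.1) (Or.inl hn.2.2)

lemma mul_right (S : RatioSystem p r) {x y z : X} (h : ¬ Collinear ℝ {p x, p y, p z})
    (hn : Neighbour p r y z) :
    r x z = r x y * r y z := S.mul x y z h (Or.inr hn.2.2) (Or.inr hn.2.1)

lemma neighbour_trans (S : RatioSystem p r) {x c d : X} (h : ¬ Collinear ℝ {p c, p x, p d})
    (hc : Neighbour p r x c)
    (hd : Neighbour p r x d) : Neighbour p r c d := by
  have hc' := S.neighbour_symm hc
  refine ⟨noncollinear_ne (noncollinear_swap h), ?_, ?_⟩ <;> rw [S.mul_left h hc']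
  · exact mul_ne_zero hc'.2.1 hd.2.1
  · exact ENNReal.mul_ne_top hc'.2.2 hd.2.2

/-- The multiplicative law through a neighbour, without assuming noncollinearity. -/
lemma mul_neighbour (S : RatioSystem p r) {x y c : X} (hxy : p x ≠ p y) (hc : Neighbour p r x c)
    (hcy : p c ≠ p y) :
    r x y = r x c * r c y := by
  by_cases h : Collinear ℝ {p x, p c, p y}
  · obtain ⟨d, hd, hoff⟩ := S.exists_neighbour_off x hc.1
    have n1 : ¬ Collinear ℝ {p x, p y, p d} := noncollinear_of_collinear h hxy hoff
    have n2 : ¬ Collinear ℝ {p c, p y, p d} := by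
      refine noncollinear_of_collinear (b := p x) ?_ hcy ?_
      · convert h using 1; ext; simp; tauto
      · exact noncollinear_swap (noncollinear_rotate hoff)
    have hoff' := noncollinear_swap (noncollinear_rotate hoff)
    have hcd := S.neighbour_trans hoff' hc hd
    rw [S.mul_left (noncollinear_swap n2) hcd, S.mul_left hoff' (S.neighbour_symm hc),
      ← mul_assoc, ← mul_assoc, S.neighbour_mul hc, one_mul, ← S.mul_left (noncollinear_swap n1) hd]
  · exact S.mul_left h hc

/-- The relative weight of two points with equal values, measured through a neighbour of the
first, does not depend on the neighbour. -/
lemma mul_neighbour_eq (S : RatioSystem p r) {x y c d : X} (hxy : p x = p y)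
    (hc : Neighbour p r x c)
    (hd : Neighbour p r x d) : r x c * r c y = r x d * r d y := by
  have key : ∀ {c d : X}, Neighbour p r x c → Neighbour p r x d →
      ¬ Collinear ℝ {p x, p c, p d} → r x c * r c y = r x d * r d y := by
    intro c d hc hd h
    have h1 : ¬ Collinear ℝ {p c, p x, p d} := noncollinear_swap (noncollinear_rotate h)
    have h2 : ¬ Collinear ℝ {p c, p d, p y} := hxy ▸ noncollinear_rotate h
    rw [S.mul_left h2 (S.neighbour_trans h1 hc hd), S.mul_left h1 (S.neighbour_symm hc),
      ← mul_assoc, ← mul_assoc, S.neighbour_mul hc, one_mul]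
  by_cases h : Collinear ℝ {p x, p c, p d}
  · obtain ⟨e, he, hoff⟩ := S.exists_neighbour_off x hc.1
    rw [key hc he hoff, ← key hd he (noncollinear_of_collinear h hd.1 hoff)]
  · exact key hc hd h

lemma through_of_ne (S : RatioSystem p r) {x y : X} (h : p x ≠ p y) : through p r x y = r x y := by
  have hex := S.exists_neighbour_ne x y
  rw [through, dif_pos hex]
  exact (S.mul_neighbour h hex.choose_spec.1 hex.choose_spec.2).symm

lemma through_eq (S : RatioSystem p r) {x y c : X} (hc : Neighbour p r x c) (hcy : p c ≠ p y) :
    through p r x y = r x c * r c y := by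
  by_cases h : p x = p y
  · have hex := S.exists_neighbour_ne x y
    rw [through, dif_pos hex]
    exact S.mul_neighbour_eq h hex.choose_spec.1 hc
  · rw [S.through_of_ne h, S.mul_neighbour h hc hcy]

lemma through_self (S : RatioSystem p r) (x : X) : through p r x x = 1 := by
  obtain ⟨c, hc, hne⟩ := S.exists_neighbour_ne x x
  rw [S.through_eq hc hne, S.neighbour_mul hc]

/-- The extended relative weights are multiplicative on all triples, the indeterminate product
`0 * ∞` excepted. -/
lemma through_mul (S : RatioSystem p r) (x y z : X) (s₁ : through p r x y ≠ 0 ∨ through p r y z ≠ ⊤)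
    (s₂ : through p r x y ≠ ⊤ ∨ through p r y z ≠ 0) :
    through p r x z = through p r x y * through p r y z := by
  by_cases hcol : Collinear ℝ {p x, p y, p z}
  · -- A neighbour `d` of `x` off the line through the three values carries the relation over.
    obtain ⟨d, hd, hdy, hdz, hoff⟩ : ∃ d, Neighbour p r x d ∧ p d ≠ p y ∧ p d ≠ p z ∧
        (p y ≠ p z → ¬ Collinear ℝ {p d, p y, p z}) := by
      by_cases hyz : p y = p z
      · obtain ⟨d, hd, hdy⟩ := S.exists_neighbour_ne x y
        exact ⟨d, hd, hdy, hyz ▸ hdy, fun h => absurd hyz h⟩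
      · have hn : ∃ d, Neighbour p r x d ∧ ¬ Collinear ℝ {p d, p y, p z} := by
          by_cases hxy : p x = p y
          · obtain ⟨d, hd, h⟩ := S.exists_neighbour_off x (v := p z) (hxy ▸ hyz)
            exact ⟨d, hd, hxy ▸ noncollinear_rotate (noncollinear_rotate h)⟩
          · obtain ⟨d, hd, h⟩ := S.exists_neighbour_off x hxy
            refine ⟨d, hd, ?_⟩
            have h1 : ¬ Collinear ℝ {p y, p z, p d} := by
              refine noncollinear_of_collinear (b := p x) ?_ hyz ?_
              · convert hcol using 1; ext; simp; tauto
              · exact noncollinear_swap (noncollinear_rotate h)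
            exact noncollinear_rotate (noncollinear_rotate h1)
        obtain ⟨d, hd, h⟩ := hn
        exact ⟨d, hd, noncollinear_ne h, noncollinear_ne (noncollinear_swap h), fun _ => h⟩
    rw [S.through_eq hd hdy, Ne, Ne, ennreal_mul_eq_zero hd.2.1] at s₁
    rw [S.through_eq hd hdy, Ne, Ne, ennreal_mul_eq_top hd.2.1 hd.2.2] at s₂
    rw [S.through_eq hd hdy, S.through_eq hd hdz, mul_assoc]
    congr 1
    by_cases hyz : p y = p z
    · obtain ⟨e, he, h⟩ := S.exists_neighbour_off y hdy.symm
      have hez : p e ≠ p z := hyz ▸ (noncollinear_ne (noncollinear_swap h)).symm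
      have n1 : ¬ Collinear ℝ {p d, p y, p e} := noncollinear_swap (noncollinear_rotate h)
      have n2 : ¬ Collinear ℝ {p d, p e, p z} := hyz ▸ noncollinear_rotate h
      have hde : r d e = r d y * r y e := S.mul_right n1 he
      rw [S.through_eq he hez, ennreal_mul_eq_top he.2.1 he.2.2] at s₁
      rw [S.through_eq he hez, ennreal_mul_eq_zero he.2.1] at s₂
      rw [S.through_eq he hez, ← mul_assoc, ← hde]
      apply S.mul d e z n2 <;> rw [hde]
      · rwa [Ne, mul_comm, ennreal_mul_eq_zero he.2.1]
      · rwa [Ne, ennreal_mul_eq_top' he.2.1 he.2.2]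
    · rw [S.through_of_ne hyz] at s₁ s₂ ⊢
      exact S.mul d y z (hoff hyz) s₁ s₂
  · have h1 := noncollinear_ne hcol
    have h2 := noncollinear_ne (noncollinear_rotate hcol)
    have h3 := noncollinear_ne (noncollinear_swap hcol)
    rw [S.through_of_ne h1, S.through_of_ne h2] at s₁ s₂ ⊢
    rw [S.through_of_ne h3]
    exact S.mul x y z hcol s₁ s₂

end RatioSystem

end Cocycle

/-! ### From relative weights to a weak order with weights -/

/-- Relative weights with values in `[0, ∞]` that are multiplicative (the indeterminate product
`0 * ∞` excepted) come from a weak order, ranking `x` at least as high as `y` unless the weight of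
`x` relative to `y` vanishes, and weights normalised to `1` at one point of each class. -/
lemma exists_weakOrder_of_cocycle {X : Type*} (ρ : X → X → ENNReal) (h1 : ∀ x, ρ x x = 1)
    (hmul : ∀ x y z, (ρ x y ≠ 0 ∨ ρ y z ≠ ⊤) → (ρ x y ≠ ⊤ ∨ ρ y z ≠ 0) →
      ρ x z = ρ x y * ρ y z) :
    ∃ (R : X → X → Prop) (w : X → ℝ), IsWeakOrder R ∧ (∀ x, 0 < w x) ∧
      (∀ x y, R x y ↔ ρ x y ≠ 0) ∧
      ∀ x y, ρ x y ≠ 0 → ρ x y ≠ ⊤ → ρ x y = ENNReal.ofReal (w x / w y) := by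
  have hinv : ∀ x y, ρ x y = (ρ y x)⁻¹ := by
    intro x y
    by_cases s : (ρ x y ≠ 0 ∨ ρ y x ≠ ⊤) ∧ (ρ x y ≠ ⊤ ∨ ρ y x ≠ 0)
    · exact ENNReal.eq_inv_of_mul_eq_one_left (by rw [← hmul x y x s.1 s.2, h1])
    · rw [not_and_or, not_or, not_or] at s
      push Not at s
      rcases s with s | s <;> simp [s]
  have htrans : ∀ x y z, ρ x y ≠ 0 → ρ y z ≠ 0 → ρ x z ≠ 0 := fun x y z h h' => by
    rw [hmul x y z (Or.inl h) (Or.inr h')]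
    exact mul_ne_zero h h'
  have hflip : ∀ x y, ρ x y ≠ ⊤ ↔ ρ y x ≠ 0 := fun x y => by
    rw [hinv x y]; simp
  let s : Setoid X :=
    { r := fun x y => ρ x y ≠ 0 ∧ ρ y x ≠ 0
      iseqv :=
        { refl := fun x => by simp [h1]
          symm := fun h => ⟨h.2, h.1⟩
          trans := fun h h' => ⟨htrans _ _ _ h.1 h'.1, htrans _ _ _ h'.2 h.2⟩ } }
  let rep : X → X := fun x => (Quotient.mk s x).out
  have hrep : ∀ x, ρ x (rep x) ≠ 0 ∧ ρ (rep x) x ≠ 0 := fun x =>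
    s.symm (Quotient.exact (Quotient.out_eq (Quotient.mk s x)))
  have hrept : ∀ x, ρ x (rep x) ≠ ⊤ := fun x => (hflip _ _).2 (hrep x).2
  refine ⟨fun x y => ρ x y ≠ 0, fun x => (ρ x (rep x)).toReal,
    ⟨fun x => by simp [h1], htrans, fun x y => ?_⟩,
    fun x => ENNReal.toReal_pos (hrep x).1 (hrept x), fun _ _ => Iff.rfl, fun x y h0 ht => ?_⟩
  · by_cases h : ρ x y = 0
    · right; rw [hinv y x, h]; simp
    · exact Or.inl h
  · have hr : rep x = rep y :=
      congrArg Quotient.out (Quotient.sound (s := s) ⟨h0, (hflip _ _).1 ht⟩)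
    have e : ρ x y = ρ x (rep x) * ρ (rep x) y :=
      hmul _ _ _ (Or.inl (hrep x).1) (Or.inl (hrept x))
    dsimp only
    rw [ENNReal.ofReal_div_of_pos (ENNReal.toReal_pos (hrep y).1 (hrept y)),
      ENNReal.ofReal_toReal (hrept x), ENNReal.ofReal_toReal (hrept y), e, hinv (rep x) y, hr,
      ENNReal.div_eq_inv_mul, mul_comm]

/-! ### Weighted averages over highest-ordered elements -/

section Average

variable {X H : Type*} [NormedAddCommGroup H] [NormedSpace ℝ H]

open Classical in
/-- The highest-ordered elements of a finite set; `ModelAggregation.maximals` without the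
nonemptiness proof. -/
noncomputable def topOf (R : X → X → Prop) (A : Finset X) : Finset X :=
  A.filter (fun x => ∀ y ∈ A, R x y)

/-- The `w`-weighted average of the values `p x` over the highest-ordered elements of `A`; it is
`0` for `A = ∅`. -/
noncomputable def topAverage (p : X → H) (R : X → X → Prop) (w : X → ℝ) (A : Finset X) : H :=
  ∑ x ∈ topOf R A, (w x / ∑ y ∈ topOf R A, w y) • p x

variable {p : X → H} {R : X → X → Prop} {w : X → ℝ}

lemma topAverage_eq (A : Finset X) :
    topAverage p R w A = (∑ y ∈ topOf R A, w y)⁻¹ • ∑ x ∈ topOf R A, w x • p x := by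
  rw [topAverage, Finset.smul_sum]
  refine Finset.sum_congr rfl fun x _ => ?_
  rw [smul_smul, div_eq_inv_mul]

lemma ModelAggregation.IsWeakOrder.exists_top (hR : IsWeakOrder R) {A : Finset X}
    (hA : A.Nonempty) :
    ∃ t ∈ A, ∀ y ∈ A, R t y := by
  induction hA using Finset.Nonempty.cons_induction with
  | singleton a => exact ⟨a, by simp, by simpa using hR.refl a⟩
  | cons a A h _ ih =>
    obtain ⟨t, ht, hmax⟩ := ih
    rcases hR.complete a t with hat | hta
    · exact ⟨a, by simp, by
        simpa using ⟨hR.refl a, fun y hy => hR.trans _ _ _ hat (hmax y hy)⟩⟩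
    · exact ⟨t, by simp [ht], by simpa using ⟨hta, hmax⟩⟩

open Classical in
lemma topOf_eq_filter (hR : IsWeakOrder R) {A : Finset X} {t : X} (ht : ∀ y ∈ A, R t y)
    (hx : ∃ x ∈ A, R x t) : topOf R A = A.filter (fun x => R x t) := by
  obtain ⟨x₀, hx₀, hxt⟩ := hx
  exact Finset.filter_congr fun x _ =>
    ⟨fun h => hR.trans _ _ _ (h x₀ hx₀) hxt, fun h y hy => hR.trans _ _ _ h (ht y hy)⟩

lemma topAverage_singleton (hR : IsWeakOrder R) (hw : ∀ x, 0 < w x) (x : X) :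
    topAverage p R w {x} = p x := by
  have : topOf R {x} = {x} := by
    ext y; simp only [topOf, Finset.mem_filter, Finset.mem_singleton, forall_eq]
    exact ⟨fun h => h.1, fun h => ⟨h, h ▸ hR.refl _⟩⟩
  simp [topAverage, this, (hw x).ne']

open Classical in
/-- If `A` reaches a level `t` bounding the disjoint sets `A` and `B` then the average over
`A ∪ B` is a convex combination of those over `A` and `B` with a positive coefficient at `A`; the
coefficient at `B` is positive as well if `B` also reaches the level. -/
lemma exists_topAverage_union (hR : IsWeakOrder R) (hw : ∀ x, 0 < w x) {A B : Finset X}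
    (hd : Disjoint A B) {t : X} (hA : ∀ y ∈ A, R t y) (hB : ∀ y ∈ B, R t y)
    (hx : ∃ x ∈ A, R x t) :
    ∃ s : ℝ, 0 < s ∧ s ≤ 1 ∧ ((∃ y ∈ B, R y t) → s < 1) ∧
      topAverage p R w (A ∪ B) = s • topAverage p R w A + (1 - s) • topAverage p R w B := by
  have hAB : topOf R (A ∪ B) = A.filter (fun x => R x t) ∪ B.filter (fun x => R x t) := by
    rw [← Finset.filter_union]
    refine topOf_eq_filter hR (fun y hy => ?_) ?_
    · rcases Finset.mem_union.1 hy with h | h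
      exacts [hA y h, hB y h]
    · obtain ⟨x, hx, h⟩ := hx
      exact ⟨x, Finset.mem_union_left _ hx, h⟩
  have hAt := topOf_eq_filter hR hA hx
  by_cases hy : ∃ y ∈ B, R y t
  · have hBt := topOf_eq_filter hR hB hy
    rw [← hAt, ← hBt] at hAB
    have hdis : Disjoint (topOf R A) (topOf R B) :=
      Finset.disjoint_of_subset_left (Finset.filter_subset _ _)
        (Finset.disjoint_of_subset_right (Finset.filter_subset _ _) hd)
    have hpA : 0 < ∑ x ∈ topOf R A, w x := by
      refine Finset.sum_pos (fun x _ => hw x) ?_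
      obtain ⟨x, hx, h⟩ := hx
      exact ⟨x, by rw [hAt]; simp [hx, h]⟩
    have hpB : 0 < ∑ x ∈ topOf R B, w x := by
      refine Finset.sum_pos (fun x _ => hw x) ?_
      obtain ⟨x, hx, h⟩ := hy
      exact ⟨x, by rw [hBt]; simp [hx, h]⟩
    rw [topAverage_eq, topAverage_eq, topAverage_eq, hAB, Finset.sum_union hdis,
      Finset.sum_union hdis]
    generalize ∑ x ∈ topOf R A, w x = a at *
    generalize ∑ x ∈ topOf R B, w x = b at *
    have hab : 0 < a + b := add_pos hpA hpB
    refine ⟨a / (a + b), div_pos hpA hab, ?_, fun _ => ?_, ?_⟩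
    · rw [div_le_one hab]; linarith
    · rw [div_lt_one hab]; linarith
    · match_scalars <;> field_simp
      ring
  · have hBe : B.filter (fun x => R x t) = ∅ := by
      rw [Finset.filter_eq_empty_iff]
      push Not at hy
      exact fun {x} hx => hy x hx
    rw [hBe, Finset.union_empty, ← hAt] at hAB
    exact ⟨1, one_pos, le_rfl, fun h => absurd h hy, by simp [topAverage, hAB]⟩

open Classical in
lemma topAverage_union_mem_segment (hR : IsWeakOrder R) (hw : ∀ x, 0 < w x) {A B : Finset X}
    (hA : A.Nonempty) (hd : Disjoint A B) :
    topAverage p R w (A ∪ B) ∈ segment ℝ (topAverage p R w A) (topAverage p R w B) := by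
  obtain ⟨t, ht, hmax⟩ := hR.exists_top (A := A ∪ B) (hA.mono Finset.subset_union_left)
  have h1 : ∀ y ∈ A, R t y := fun y hy => hmax y (Finset.mem_union_left _ hy)
  have h2 : ∀ y ∈ B, R t y := fun y hy => hmax y (Finset.mem_union_right _ hy)
  rcases Finset.mem_union.1 ht with h | h
  · obtain ⟨s, h0, hs, -, e⟩ :=
      exists_topAverage_union (p := p) hR hw hd h1 h2 ⟨t, h, hR.refl t⟩
    exact ⟨s, 1 - s, h0.le, by linarith, by ring, e.symm⟩
  · obtain ⟨s, h0, hs, -, e⟩ :=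
      exists_topAverage_union (p := p) hR hw hd.symm h2 h1 ⟨t, h, hR.refl t⟩
    rw [segment_symm, Finset.union_comm]
    exact ⟨s, 1 - s, h0.le, by linarith, by ring, e.symm⟩

open Classical in
/-- Adding a point `d` ranked at least as high as every point of `A`. -/
lemma exists_topAverage_insert (hR : IsWeakOrder R) (hw : ∀ x, 0 < w x) {A : Finset X} {d : X}
    (hd : d ∉ A) (hA : ∀ y ∈ A, R d y) :
    ∃ s : ℝ, 0 < s ∧ ((∃ y ∈ A, R y d) → s ≠ 1) ∧
      topAverage p R w (insert d A) = s • p d + (1 - s) • topAverage p R w A := by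
  obtain ⟨s, h0, -, h1, e⟩ := exists_topAverage_union (p := p) hR hw
    (A := {d}) (B := A) (by simpa using hd) (by simpa using hR.refl d) hA ⟨d, by simp, hR.refl d⟩
  rw [topAverage_singleton hR hw] at e
  exact ⟨s, h0, fun h => (h1 h).ne, by rw [Finset.insert_eq, e]⟩

/-- The average over a pair of equally ranked points. -/
lemma topAverage_pair_of_equiv [DecidableEq X] (hR : IsWeakOrder R) {x y : X} (hne : x ≠ y)
    (hxy : R x y) (hyx : R y x) :
    topAverage p R w {x, y} = (w x / (w x + w y)) • p x + (w y / (w x + w y)) • p y := by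
  have : topOf R {x, y} = {x, y} := by
    simp only [topOf, Finset.filter_eq_self]
    simp [hR.refl, hxy, hyx]
  rw [topAverage, this, Finset.sum_pair hne, Finset.sum_pair hne]

/-- The average over a pair whose second point is ranked strictly lower. -/
lemma topAverage_pair_of_not [DecidableEq X] (hR : IsWeakOrder R) (hw : ∀ x, 0 < w x) {x y : X}
    (hyx : ¬ R y x) : topAverage p R w {x, y} = p x := by
  have hxy : R x y := (hR.complete x y).resolve_right hyx
  have : topOf R {x, y} = {x} := by
    ext z
    simp only [topOf, Finset.mem_filter, Finset.mem_insert, Finset.mem_singleton,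
      forall_eq_or_imp, forall_eq]
    constructor
    · rintro ⟨rfl | rfl, h, -⟩
      exacts [rfl, absurd h hyx]
    · rintro rfl
      exact ⟨Or.inl rfl, hR.refl _, hxy⟩
  simp [topAverage, this, (hw x).ne']

end Average

/-! ### Pairs determine all coalitions -/

section Induction

variable {X H : Type*} [NormedAddCommGroup H] [NormedSpace ℝ H]

open Classical in
/-- An averaging set function that agrees with the weighted average on singletons and pairs agrees
with it on all finite sets, provided every point is equivalent to two points with which it forms a
noncollinear triple. -/
theorem eq_topAverage_of_pairs {F : Finset X → H} {R : X → X → Prop} {w : X → ℝ} {p : X → H}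
    (hF : ∀ A B : Finset X, A.Nonempty → B.Nonempty → Disjoint A B →
      F (A ∪ B) ∈ segment ℝ (F A) (F B))
    (hR : IsWeakOrder R) (hw : ∀ x, 0 < w x) (hp : ∀ x, F {x} = p x)
    (hpair : ∀ x y, x ≠ y → F {x, y} = topAverage p R w {x, y})
    (hrich : ∀ x, ∃ a b, ¬ Collinear ℝ {p x, p a, p b} ∧ (R x a ∧ R a x) ∧ (R x b ∧ R b x))
    (A : Finset X) (hA : A.Nonempty) : F A = topAverage p R w A := by
  induction hn : A.card using Nat.strong_induction_on generalizing A with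
  | _ n ih =>
  subst hn
  set G := topAverage p R w with hG
  have hGs : ∀ x, G {x} = p x := topAverage_singleton hR hw
  have seg : ∀ B : Finset X, 2 ≤ B.card → B.card ≤ A.card → ∀ x ∈ B,
      F B ∈ segment ℝ (p x) (G (B.erase x)) ∧ G B ∈ segment ℝ (p x) (G (B.erase x)) ∧
      G (B.erase x) = F (B.erase x) := by
    intro B h2 hBA x hx
    have hc : (B.erase x).card = B.card - 1 := Finset.card_erase_of_mem hx
    have hne : (B.erase x).Nonempty := Finset.card_pos.1 (by omega)
    have hdis : Disjoint {x} (B.erase x) := by simp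
    have hB : {x} ∪ B.erase x = B := by
      rw [← Finset.insert_eq, Finset.insert_erase hx]
    have e := ih _ (by omega) (B.erase x) hne rfl
    have h1 := hF {x} (B.erase x) (by simp) hne hdis
    have h3 := topAverage_union_mem_segment (p := p) hR hw (A := {x}) (by simp) hdis
    rw [hB, hp, e] at h1
    rw [hB, ← hG, hGs] at h3
    exact ⟨h1, h3, e.symm⟩
  -- A set of at most the current size on which `F` and `G` differ has all its values on a line.
  have line : ∀ B : Finset X, 2 ≤ B.card → B.card ≤ A.card → F B ≠ G B → ∀ x ∈ B,
      p x ∈ line[ℝ, F B, G B] ∧ G (B.erase x) ∈ line[ℝ, F B, G B] := by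
    intro B h2 hBA hbad x hx
    obtain ⟨h1, h3, -⟩ := seg B h2 hBA x hx
    exact endpoints_mem_line hbad h1 h3
  have hApos : 0 < A.card := hA.card_pos
  by_cases hA1 : A.card = 1
  · obtain ⟨x, rfl⟩ := Finset.card_eq_one.1 hA1
    rw [hp, hGs]
  by_cases hA2 : A.card = 2
  · obtain ⟨x, y, hxy, rfl⟩ := Finset.card_eq_two.1 hA2
    exact hpair x y hxy
  by_contra hbad
  have hAL := line A (by omega) le_rfl hbad
  -- The average after deleting a point never equals the value at that point.
  have hdeg : ∀ x ∈ A, p x ≠ G (A.erase x) := by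
    intro x hx h
    obtain ⟨h1, h3, -⟩ := seg A (by omega) le_rfl x hx
    rw [← h, segment_same, Set.mem_singleton_iff] at h1 h3
    exact hbad (h1.trans h3.symm)
  obtain ⟨x, hx, y, hy, z, hz, hyz⟩ : ∃ x ∈ A, ∃ y ∈ A.erase x, ∃ z ∈ A.erase x, p y ≠ p z := by
    by_contra! hcon
    obtain ⟨a, b, c, ha, hb, hc, hab, hac, hbc⟩ :=
      Finset.two_lt_card_iff.1 (show 2 < A.card by omega)
    -- Any two points of `A` avoid a third one, so all values agree.
    have hconst : ∀ u ∈ A, ∀ v ∈ A, p u = p v := by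
      intro u hu v hv
      have : ∃ x ∈ A, u ≠ x ∧ v ≠ x := by
        by_contra! h'
        have e1 := h' a ha
        have e2 := h' b hb
        have e3 := h' c hc
        by_cases h1 : u = a
        · subst h1
          exact hbc ((e2 hab).symm.trans (e3 hac))
        · have := e1 h1
          subst this
          by_cases h2 : u = b
          · subst h2
            exact hac (e3 hbc)
          · exact hab (e2 h2)
      obtain ⟨x, hx, h1, h2⟩ := this
      exact hcon x hx u (by simp [h1, hu]) v (by simp [h2, hv])
    apply hdeg a ha
    rw [hG, topAverage]
    have hT : ∀ y ∈ topOf R (A.erase a), p y = p a := fun y hy =>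
      hconst y (Finset.mem_of_mem_erase (Finset.mem_of_mem_filter y hy)) a ha
    rw [Finset.sum_congr rfl fun y hy => by rw [hT y hy], ← Finset.sum_smul, ← Finset.sum_div,
      div_self, one_smul]
    obtain ⟨t, ht, hmax⟩ := hR.exists_top (A := A.erase a) ⟨b, by simp [hb, hab.symm]⟩
    exact (Finset.sum_pos (fun x _ => hw x) ⟨t, Finset.mem_filter.2 ⟨ht, hmax⟩⟩).ne'
  -- A point `d` off the line and equivalent to the highest-ranked points of `A`.
  obtain ⟨t, ht, hmax⟩ := hR.exists_top hA
  obtain ⟨d, hdL, htd, hdt⟩ : ∃ d, p d ∉ line[ℝ, F A, G A] ∧ R t d ∧ R d t := by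
    obtain ⟨a, b, hab, ha, hb⟩ := hrich t
    by_cases haL : p a ∈ line[ℝ, F A, G A]
    · by_cases hbL : p b ∈ line[ℝ, F A, G A]
      · exact absurd (collinear_triple_of_mem_affineSpan_pair (hAL t ht).1 haL hbL) hab
      · exact ⟨b, hbL, hb⟩
    · exact ⟨a, haL, ha⟩
  have hdA : d ∉ A := fun h => hdL (hAL d h).1
  have hdmax : ∀ y ∈ A, R d y := fun y hy => hR.trans _ _ _ hdt (hmax y hy)
  have hdx : d ≠ x := fun h => hdA (h ▸ hx)
  have hcard : (A.erase x).card = A.card - 1 := Finset.card_erase_of_mem hx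
  have hyA := Finset.mem_of_mem_erase hy
  have hzA := Finset.mem_of_mem_erase hz
  -- The noncollinear set `insert d (A.erase x)` of the current size is not exceptional.
  have hgood : F (insert d (A.erase x)) = G (insert d (A.erase x)) := by
    by_contra hbad'
    have hc : (insert d (A.erase x)).card = A.card := by
      rw [Finset.card_insert_of_notMem (by simp [hdA]), hcard]; omega
    have h' := line _ (by omega) hc.le hbad'
    exact hdL (mem_line_of_two_common hyz (hAL y hyA).1 (hAL z hzA).1
      (h' y (Finset.mem_insert_of_mem hy)).1 (h' z (Finset.mem_insert_of_mem hz)).1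
      (h' d (Finset.mem_insert_self _ _)).1)
  have hsplit1 : {x} ∪ insert d (A.erase x) = insert d A := by
    rw [← Finset.insert_eq, Finset.insert_comm, Finset.insert_erase hx]
  have hsplit2 : A.erase x ∪ {d, x} = insert d A := by
    rw [Finset.union_comm, Finset.insert_union, ← Finset.insert_eq, Finset.insert_erase hx]
  have hdis1 : Disjoint {x} (insert d (A.erase x)) := by simp [hdx.symm]
  have hdis2 : Disjoint (A.erase x) {d, x} := by simp [hdA]
  have hne : (A.erase x).Nonempty := ⟨y, hy⟩
  have hAd : F (insert d A) = G (insert d A) := by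
    by_contra hbad'
    have f1 := hF _ _ (by simp) (by simp) hdis1
    have f2 := hF _ _ hne (by simp) hdis2
    have g1 := topAverage_union_mem_segment (p := p) hR hw (by simp) hdis1
    have g2 := topAverage_union_mem_segment (p := p) hR hw hne hdis2
    rw [hsplit1, hp, hgood] at f1
    rw [hsplit2, hpair d x hdx, ← (seg A (by omega) le_rfl x hx).2.2] at f2
    rw [hsplit1, ← hG, hGs] at g1
    rw [hsplit2, ← hG] at g2
    have l1 := (endpoints_mem_line hbad' f1 g1).1
    have l2 := endpoints_mem_line hbad' f2 g2
    have hdx' := mem_line_of_two_common (hdeg x hx) (hAL x hx).1 (hAL x hx).2 l1 l2.1 l2.2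
    obtain ⟨s, h0, -, e⟩ := exists_topAverage_insert (p := p) hR hw (A := {x}) (d := d)
      (by simpa using hdx) (by simpa using hdmax x hx)
    rw [← hG, hGs] at e
    rw [e] at hdx'
    exact hdL (mem_of_combo_mem h0.ne' (hAL x hx).1 hdx')
  -- Projecting from `d` back to the line recovers the value at `A`.
  obtain ⟨s, -, h1, e⟩ := exists_topAverage_insert (p := p) hR hw hdA hdmax
  have hs := h1 ⟨t, ht, htd⟩
  obtain ⟨a, b, -, -, hab, e'⟩ := hF {d} A (by simp) hA (by simpa using hdA)
  rw [← Finset.insert_eq, hAd, hp, eq_sub_iff_add_eq'.2 hab] at e'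
  exact hbad (eq_of_combo_eq hdL (right_mem_affineSpan_pair ℝ _ _)
    (left_mem_affineSpan_pair ℝ _ _) hs (e.symm.trans e'.symm)).symm

end Induction

/-! ### Aggregation rules -/

section Aggregation

variable {X H : Type*} [NormedAddCommGroup H]

open Classical in
/-- An aggregation rule as a function of all finite sets, with the value `0` at `∅`. -/
noncomputable def onFinset (f : Coalition X → H) (A : Finset X) : H :=
  if h : A.Nonempty then f ⟨A, h⟩ else 0

lemma onFinset_coe (f : Coalition X → H) (A : Coalition X) : onFinset f A.1 = f A := by
  rw [onFinset, dif_pos A.2]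

lemma onFinset_singleton (f : Coalition X → H) (x : X) : onFinset f {x} = f (single x) :=
  onFinset_coe f (single x)

open Classical in
lemma onFinset_pair (f : Coalition X → H) (x y : X) : onFinset f {x, y} = f (pair x y) := by
  rw [Finset.insert_eq]; exact onFinset_coe f (pair x y)

variable [NormedSpace ℝ H]

lemma represents_iff {f : Coalition X → H} {R : X → X → Prop} {w : X → ℝ} :
    Represents f R w ↔ (∀ x, 0 < w x) ∧
      ∀ A : Coalition X, f A = topAverage (fun x => f (single x)) R w A.1 := Iff.rfl

open Classical in
lemma ModelAggregation.WeightedAveraging.onFinset_union {f : Coalition X → H}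
    (hf : WeightedAveraging f)
    {A B : Finset X} (hA : A.Nonempty) (hB : B.Nonempty) (hd : Disjoint A B) :
    onFinset f (A ∪ B) ∈ segment ℝ (onFinset f A) (onFinset f B) := by
  obtain ⟨l, hl, e⟩ := hf ⟨A, hA⟩ ⟨B, hB⟩ hd
  have h1 := onFinset_coe f (union ⟨A, hA⟩ ⟨B, hB⟩)
  have h2 := onFinset_coe f ⟨A, hA⟩
  have h3 := onFinset_coe f ⟨B, hB⟩
  refine ⟨l, 1 - l, hl.1, by linarith [hl.2], by ring, ?_⟩
  rw [h2, h3, ← e, ← h1]; rfl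

lemma pair_comm (x y : X) : pair x y = pair y x := by
  classical exact Subtype.ext (Finset.union_comm _ _)

lemma pair_self (x : X) : pair x x = single x := by
  classical exact Subtype.ext (Finset.union_self _)

section Representation

variable {f : Coalition X → H} {R : X → X → Prop} {w : X → ℝ}

lemma ModelAggregation.Represents.pair_of_equiv (hR : IsWeakOrder R) (h : Represents f R w)
    {x y : X}
    (hne : x ≠ y) (hxy : R x y) (hyx : R y x) :
    f (pair x y) = (w x / (w x + w y)) • f (single x) +
      (1 - w x / (w x + w y)) • f (single y) := by
  classical
  have hw : w x + w y ≠ 0 := (add_pos (h.1 x) (h.1 y)).ne'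
  have e : 1 - w x / (w x + w y) = w y / (w x + w y) := by field_simp; ring
  rw [e, ← topAverage_pair_of_equiv (p := fun x => f (single x)) hR hne hxy hyx, Finset.insert_eq]
  convert h.2 (pair x y) using 1
  rw [topAverage, pair, union]
  simp only [single]
  congr!

lemma ModelAggregation.Represents.pair_of_not (hR : IsWeakOrder R) (h : Represents f R w) {x y : X}
    (hyx : ¬ R y x) : f (pair x y) = f (single x) := by
  classical
  rw [← topAverage_pair_of_not (p := fun x => f (single x)) hR h.1 hyx, Finset.insert_eq]
  convert h.2 (pair x y) using 1
  rw [topAverage, pair, union]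
  simp only [single]
  congr!

/-- Between points with different values the order can be read off from the pair. -/
lemma ModelAggregation.Represents.rel_iff (hR : IsWeakOrder R) (h : Represents f R w) {x y : X}
    (hp : f (single x) ≠ f (single y)) : R x y ↔ f (pair x y) ≠ f (single y) := by
  have hne : x ≠ y := fun e => hp (by rw [e])
  constructor
  · intro hxy he
    by_cases hyx : R y x
    · rw [h.pair_of_equiv hR hne hxy hyx] at he
      have h0 := combo_left_cancel hp (t := 0) (by rw [he]; simp)
      exact (div_pos (h.1 x) (add_pos (h.1 x) (h.1 y))).ne' h0
    · exact hp ((h.pair_of_not hR hyx).symm.trans he)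
  · intro he
    by_contra hxy
    exact he (by rw [pair_comm, h.pair_of_not hR hxy])

lemma ModelAggregation.Represents.equiv_of_pair_notMem (hR : IsWeakOrder R) (h : Represents f R w)
    {x y : X}
    (hm : f (pair x y) ∉ ({f (single x), f (single y)} : Set H)) : R x y ∧ R y x := by
  simp only [Set.mem_insert_iff, Set.mem_singleton_iff, not_or] at hm
  constructor <;> by_contra hn
  · exact hm.2 (by rw [pair_comm, h.pair_of_not hR hn])
  · exact hm.1 (h.pair_of_not hR hn)

/-- Every point has a partner of properly mixed pair value whose own value differs from that of
any two prescribed points with equal values. -/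
lemma ModelAggregation.StronglyRich.exists_partner (hf : StronglyRich f) (x y : X) : ∃ c,
    f (pair x c) ∉ ({f (single x), f (single c)} : Set H) ∧ f (single c) ≠ f (single y) := by
  obtain ⟨a, b, hab, ha, hb⟩ := hf x
  by_cases h : f (single a) = f (single y)
  · exact ⟨b, hb, fun h' => noncollinear_ne (noncollinear_rotate hab) (h.trans h'.symm)⟩
  · exact ⟨a, ha, h⟩

/-- A strongly rich rule is represented by at most one weak order. -/
lemma ModelAggregation.Represents.order_unique (hf : StronglyRich f) {R' : X → X → Prop}
    {w' : X → ℝ}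
    (hR : IsWeakOrder R) (h : Represents f R w) (hR' : IsWeakOrder R') (h' : Represents f R' w') :
    R = R' := by
  have key : ∀ {R R' : X → X → Prop} {w w' : X → ℝ}, IsWeakOrder R → Represents f R w →
      IsWeakOrder R' → Represents f R' w' → ∀ x y, R x y → R' x y := by
    intro R R' w w' hR h hR' h' x y hxy
    obtain ⟨c, hc, hcy⟩ := hf.exists_partner x y
    have hcR := (h.equiv_of_pair_notMem hR hc).2
    have hcR' := (h'.equiv_of_pair_notMem hR' hc).1
    have : R' c y := (h'.rel_iff hR' hcy).2 ((h.rel_iff hR hcy).1 (hR.trans _ _ _ hcR hxy))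
    exact hR'.trans _ _ _ hcR' this
  ext x y
  exact ⟨key hR h hR' h' x y, key hR' h' hR h x y⟩

lemma ModelAggregation.Represents.div_eq_of_equiv (hf : StronglyRich f) {w' : X → ℝ}
    (hR : IsWeakOrder R)
    (h : Represents f R w) (h' : Represents f R w') {x y : X} (hxy : R x y) (hyx : R y x) :
    w' x / w x = w' y / w y := by
  have key : ∀ {x y : X}, R x y → R y x → f (single x) ≠ f (single y) →
      w' x / w x = w' y / w y := by
    intro x y hxy hyx hp
    have hne : x ≠ y := fun e => hp (by rw [e])
    have e := combo_left_cancel hp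
      ((h.pair_of_equiv hR hne hxy hyx).symm.trans (h'.pair_of_equiv hR hne hxy hyx))
    have h1 := h.1 x
    have h2 := h.1 y
    have h3 := h'.1 x
    have h4 := h'.1 y
    field_simp at e ⊢
    linarith
  obtain ⟨c, hc, hcy⟩ := hf.exists_partner x y
  obtain ⟨h1, h2⟩ := h.equiv_of_pair_notMem hR hc
  by_cases hp : f (single x) = f (single y)
  · rw [key h1 h2 (hp ▸ hcy.symm)]
    exact key (hR.trans _ _ _ h2 hxy) (hR.trans _ _ _ hyx h1) hcy
  · exact key hxy hyx hp

/-- Rescaling the weights by a factor constant on equivalence classes does not matter, because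
the highest-ordered elements of a coalition form part of a single class. -/
lemma ModelAggregation.Represents.rescale (hR : IsWeakOrder R) (h : Represents f R w) {c : X → ℝ}
    (hc : ∀ x, 0 < c x) (hcc : ∀ x y, R x y → R y x → c x = c y) :
    Represents f R (fun x => c x * w x) := by
  refine ⟨fun x => mul_pos (hc x) (h.1 x), fun A => ?_⟩
  obtain ⟨t, ht, hmax⟩ := hR.exists_top A.2
  have hct : ∀ x ∈ maximals R A, c x = c t := fun x hx => by
    simp only [maximals, Finset.mem_filter] at hx
    exact hcc x t (hx.2 t ht) (hmax x hx.1)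
  have hsum : ∑ y ∈ maximals R A, c y * w y = c t * ∑ y ∈ maximals R A, w y := by
    rw [Finset.mul_sum]
    exact Finset.sum_congr rfl fun y hy => by rw [hct y hy]
  rw [h.2 A]
  refine Finset.sum_congr rfl fun x hx => ?_
  dsimp only
  rw [hsum]
  rw [hct x hx, mul_div_mul_left _ _ (hc t).ne']

lemma ModelAggregation.Represents.weightedAveraging (hR : IsWeakOrder R) (h : Represents f R w) :
    WeightedAveraging f := by
  classical
  intro A B hd
  obtain ⟨l, m, hl, hm, hlm, e⟩ :=
    topAverage_union_mem_segment (p := fun x => f (single x)) hR h.1 A.2 hd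
  refine ⟨l, ⟨hl, by linarith⟩, ?_⟩
  obtain rfl : m = 1 - l := by linarith
  rw [(represents_iff.1 h).2 A, (represents_iff.1 h).2 B, e, (represents_iff.1 h).2 (union A B)]
  simp only [union]

end Representation

/-- The shares within pairs of a strongly rich averaging rule give a `RatioSystem`: on a
noncollinear triple the three shares come from the barycentric coordinates of `f {x, y, z}`. -/
lemma ratioSystem_of_weightedAveraging {f : Coalition X → H} (hf : StronglyRich f)
    (hWA : WeightedAveraging f) {l : X → X → ℝ} (hl : ∀ x y, l x y ∈ Set.Icc (0 : ℝ) 1)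
    (hlf : ∀ x y, f (pair x y) = l x y • f (single x) + (1 - l x y) • f (single y)) :
    RatioSystem (fun x => f (single x)) (fun x y => odds (l x y)) where
  symm x y hxy := by
    have e : l x y = 1 - l y x := by
      apply combo_left_cancel hxy
      rw [← hlf, pair_comm, hlf]
      match_scalars <;> ring
    have e' : l y x = 1 - l x y := by linarith
    rw [e', odds_one_sub _ (hl x y).1 (hl x y).2]
  mul x y z hn s₁ s₂ := by
    classical
    have hxy : x ≠ y := fun h => noncollinear_ne hn (by rw [h])
    have hyz : y ≠ z := fun h => noncollinear_ne (noncollinear_rotate hn) (by rw [h])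
    have hxz : x ≠ z := fun h => noncollinear_ne (noncollinear_swap hn) (by rw [h])
    have q1 := hWA.onFinset_union (A := {x, y}) (B := {z}) (by simp) (by simp)
      (by simp [hxz.symm, hyz.symm])
    have q2 := hWA.onFinset_union (A := {y, z}) (B := {x}) (by simp) (by simp)
      (by simp [hxz, hxy])
    have q3 := hWA.onFinset_union (A := {x, z}) (B := {y}) (by simp) (by simp)
      (by simp [hxy.symm, hyz])
    have t2 : ({y, z} ∪ {x} : Finset X) = {x, y} ∪ {z} := by ext; simp; tauto
    have t3 : ({x, z} ∪ {y} : Finset X) = {x, y} ∪ {z} := by ext; simp; tauto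
    rw [onFinset_pair, onFinset_singleton, hlf] at q1 q2 q3
    rw [t2] at q2
    rw [t3] at q3
    generalize onFinset f ({x, y} ∪ {z}) = q at *
    obtain ⟨a1, b1, ha1, hb1, hab1, e1⟩ := q1
    obtain ⟨a2, b2, ha2, hb2, hab2, e2⟩ := q2
    obtain ⟨a3, b3, ha3, hb3, hab3, e3⟩ := q3
    obtain ⟨u1, u2, u3⟩ := barycentric_unique hn
      (x := a1 * l x y) (y := a1 * (1 - l x y)) (z := b1)
      (x' := b2) (y' := a2 * l y z) (z' := a2 * (1 - l y z)) (by linarith)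
      (by linear_combination (norm := module) e1 - e2)
    obtain ⟨v1, v2, v3⟩ := barycentric_unique hn
      (x := a1 * l x y) (y := a1 * (1 - l x y)) (z := b1)
      (x' := a3 * l x z) (y' := b3) (z' := a3 * (1 - l x z)) (by linarith)
      (by linear_combination (norm := module) e1 - e3)
    have p1 := (hl x y).1
    have p2 := (hl x y).2
    refine odds_mul (α := a1 * l x y) (β := a1 * (1 - l x y)) (γ := b1) (mul_nonneg ha1 p1)
      (mul_nonneg ha1 (by linarith)) hb1 (by linarith) (hl x y) (hl y z) (hl x z) (by ring)
      ?_ ?_ s₁ s₂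
    · rw [u2, u3]; ring
    · rw [v1, v3]; ring
  rich x := by
    have key : ∀ y, f (pair x y) ∉ ({f (single x), f (single y)} : Set H) →
        f (single x) ≠ f (single y) →
        Neighbour (fun x => f (single x)) (fun x y => odds (l x y)) x y := by
      intro y hy hne
      simp only [Set.mem_insert_iff, Set.mem_singleton_iff, not_or] at hy
      refine ⟨hne, ?_, ?_⟩
      · rw [Ne, odds_eq_zero (hl x y).1]
        intro h0
        exact hy.2 (by rw [hlf, h0]; simp)
      · rw [Ne, odds_eq_top (hl x y).2]
        intro h1
        exact hy.1 (by rw [hlf, h1]; simp)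
    obtain ⟨a, b, hab, ha, hb⟩ := hf x
    exact ⟨a, b, hab, key a ha (noncollinear_ne hab),
      key b hb (noncollinear_ne (noncollinear_swap hab))⟩

/-- A strongly rich averaging rule is represented by a weak order with weights. -/
lemma exists_represents {f : Coalition X → H} (hf : StronglyRich f) (hWA : WeightedAveraging f) :
    ∃ R : X → X → Prop, IsWeakOrder R ∧ ∃ w : X → ℝ, Represents f R w := by
  classical
  have hex : ∀ x y, ∃ l : ℝ, l ∈ Set.Icc (0 : ℝ) 1 ∧
      f (pair x y) = l • f (single x) + (1 - l) • f (single y) := by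
    intro x y
    by_cases h : x = y
    · subst h
      exact ⟨1, by simp, by simp [pair_self]⟩
    · exact hWA (single x) (single y) (by simpa [single] using h)
  choose l hl hlf using hex
  have S := ratioSystem_of_weightedAveraging hf hWA hl hlf
  obtain ⟨R, w, hR, hw, hRρ, hwρ⟩ := exists_weakOrder_of_cocycle _ S.through_self S.through_mul
  refine ⟨R, hR, w, hw, fun A => ?_⟩
  have hflip : ∀ x y, f (single x) ≠ f (single y) → ¬ R y x → l x y = 1 := by
    intro x y hp h
    rw [hRρ, not_not, S.through_of_ne hp.symm, S.symm x y hp, ENNReal.inv_eq_zero,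
      odds_eq_top (hl x y).2] at h
    exact h
  have hequiv : ∀ x y, f (single x) ≠ f (single y) → R x y → R y x →
      l x y = w x / (w x + w y) := by
    intro x y hp hxy hyx
    rw [hRρ, S.through_of_ne hp] at hxy
    rw [hRρ, S.through_of_ne hp.symm, S.symm x y hp, Ne, ENNReal.inv_eq_zero] at hyx
    have e := hwρ x y (by rwa [S.through_of_ne hp]) (by rwa [S.through_of_ne hp])
    have h1 : l x y < 1 := lt_of_le_of_ne (hl x y).2 (by rwa [odds_eq_top (hl x y).2] at hyx)
    have h2 := hw x
    have h3 := hw y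
    rw [S.through_of_ne hp, odds_of_lt_one h1, ENNReal.ofReal_eq_ofReal_iff
      (div_nonneg (hl x y).1 (by linarith)) (by positivity)] at e
    have h4 : 0 < 1 - l x y := by linarith
    rw [div_eq_div_iff h4.ne' h3.ne'] at e
    rw [eq_div_iff (by positivity)]
    linarith
  have hpair : ∀ x y, x ≠ y → onFinset f {x, y} =
      topAverage (fun x => f (single x)) R w {x, y} := by
    intro x y hne
    rw [onFinset_pair]
    by_cases hyx : R y x
    · by_cases hxy : R x y
      · rw [topAverage_pair_of_equiv hR hne hxy hyx, hlf]
        have hs : w x + w y ≠ 0 := (add_pos (hw x) (hw y)).ne'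
        have e : w y / (w x + w y) = 1 - w x / (w x + w y) := by field_simp; ring
        rw [e]
        by_cases hp : f (single x) = f (single y)
        · rw [hp, ← add_smul, ← add_smul]; simp
        · rw [hequiv x y hp hxy hyx]
      · rw [Finset.pair_comm, topAverage_pair_of_not hR hw hxy, pair_comm, hlf]
        by_cases hp : f (single x) = f (single y)
        · rw [hp, ← add_smul]; simp
        · rw [hflip y x (Ne.symm hp) hxy]; simp
    · rw [topAverage_pair_of_not hR hw hyx, hlf]
      by_cases hp : f (single x) = f (single y)
      · rw [hp, ← add_smul]; simp
      · rw [hflip x y hp hyx]; simp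
  have hnb : ∀ x c, Neighbour (fun x => f (single x)) (fun x y => odds (l x y)) x c →
      R x c ∧ R c x := by
    intro x c h
    rw [hRρ, hRρ, S.through_of_ne h.1, S.through_of_ne h.1.symm]
    exact ⟨h.2.1, (S.neighbour_symm h).2.1⟩
  have := eq_topAverage_of_pairs (fun A B hA hB hd => hWA.onFinset_union hA hB hd) hR hw
    (onFinset_singleton f) hpair (fun x => by
      obtain ⟨a, b, hab, ha, hb⟩ := S.rich x
      exact ⟨a, b, hab, hnb x a ha, hnb x b hb⟩) A.1 A.2
  rw [onFinset_coe] at this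
  exact this

end Aggregation

theorem theorem2 {X : Type*} [Nonempty X] {H : Type*} [NormedAddCommGroup H] [NormedSpace ℝ H]
    (f : Coalition X → H) (hf : StronglyRich f) :
    (WeightedAveraging f ↔
      ∃! R : X → X → Prop, IsWeakOrder R ∧ ∃ w : X → ℝ, Represents f R w) ∧
    (∀ (R : X → X → Prop) (w : X → ℝ), IsWeakOrder R → Represents f R w →
      ∀ w' : X → ℝ, Represents f R w' ↔
        ∃ c : X → ℝ, (∀ x, 0 < c x) ∧ (∀ x y, R x y → R y x → c x = c y) ∧
          ∀ x, w' x = c x * w x) := by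
  refine ⟨⟨fun hWA => ?_, ?_⟩, fun R w hR h w' => ⟨fun h' => ?_, ?_⟩⟩
  · obtain ⟨R, hR, w, h⟩ := exists_represents hf hWA
    refine ⟨R, ⟨hR, w, h⟩, ?_⟩
    rintro R' ⟨hR', w', h'⟩
    exact h'.order_unique hf hR' hR h
  · rintro ⟨R, ⟨hR, w, h⟩, -⟩
    exact h.weightedAveraging hR
  · exact ⟨fun x => w' x / w x, fun x => div_pos (h'.1 x) (h.1 x),
      fun x y hxy hyx => h.div_eq_of_equiv hf hR h' hxy hyx,
      fun x => (div_mul_cancel₀ _ (h.1 x).ne').symm⟩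
  · rintro ⟨c, hc, hcc, e⟩
    obtain rfl : w' = fun x => c x * w x := funext e
    exact h.rescale hR hc hcc
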